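/- Let $n\ge 2$ be an integer and $Q=[0,\infty)^n\subset\mathbb R^n$. For each permutation $\sigma$ in the symmetric group $\mathrm{Sym}(n)$ of $\{1,\dots,n\}$, let $s^{(\sigma)}\in\mathbb R\cup\{+\infty,-\infty\}$ be prescribed arbitrarily. Then there exists a function $f\in C^\infty(Q)$ such that, for every $\sigma\in\mathrm{Sym}(n)$, the iterated improper Riemann integral $$\int_0^\infty\cdots\int_0^\infty f(x_1,\dots,x_n)\,dx_{\sigma(1)}\,dx_{\sigma(2)}\cdots dx_{\sigma(n)}$$ exists and equals $s^{(\sigma)}$. Here the integration with respect to $x_{\sigma(1)}$ is carried out first (innermost) and that with respect to $x_{\sigma(n)}$ last (outermost). Existence means that each of the inner iterated improper integrals exists as a real number for all values in $[0,\infty)$ of the remaining variables, and that the outermost improper integral, i.e. the limit of the integrals over $[0,R]$ as $R\to\infty$, exists in $\mathbb R\cup\{+\infty,-\infty\}$. -/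

import Mathlib

open Filter Topology
open scoped ContDiff

/-- The one-dimensional interval from `a` to `b` (with `a < b`), as a box in `ℝ¹`. -/
def intervalBox (a b : ℝ) (h : a < b) : BoxIntegral.Box (Fin 1) where
  lower := fun _ => a
  upper := fun _ => b
  lower_lt_upper := fun _ => h

/-- `g` is Riemann integrable on `[a, b]` with integral `v`: the Riemann sums of `g` over tagged
partitions of the interval tend to `v` as the mesh of the partition tends to `0`. -/
def HasRiemannIntegral (g : ℝ → ℝ) (a b : ℝ) (h : a < b) (v : ℝ) : Prop :=
  BoxIntegral.HasIntegral (intervalBox a b h) BoxIntegral.IntegrationParams.Riemann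
    (fun y : Fin 1 → ℝ => g (y 0)) BoxIntegral.BoxAdditiveMap.volume v

/-- The improper Riemann integral `∫_0^∞ g(t) dt` exists in the extended sense and equals `s`:
`g` is Riemann integrable on `[0, R]` for every `R > 0`, and the integrals over `[0, R]` tend to
the extended real number `s` as `R → ∞`. -/
def HasImproperIntegral (g : ℝ → ℝ) (s : EReal) : Prop :=
  ∃ G : ℝ → ℝ, (∀ (R : ℝ) (hR : 0 < R), HasRiemannIntegral g 0 R hR (G R)) ∧
    Tendsto (fun R : ℝ => (G R : EReal)) atTop (𝓝 s)

/-- The iterated improper integral `∫_0^∞ … ∫_0^∞ h(y_1, …, y_n) dy_1 … dy_n` exists and equals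
`s`. The first variable is integrated first (innermost), the last variable last (outermost).
All inner iterated integrals have to exist as real numbers, for all values in `[0, ∞)` of the
remaining variables; only the outermost integral may be infinite. -/
def HasIteratedImproperIntegral : (n : ℕ) → ((Fin n → ℝ) → ℝ) → EReal → Prop
  | 0, h, s => s = ((h Fin.elim0 : ℝ) : EReal)
  | n + 1, h, s => ∃ F : ℝ → ℝ,
      (∀ t : ℝ, 0 ≤ t →
        HasIteratedImproperIntegral n (fun y => h (Fin.snoc y t)) ((F t : ℝ) : EReal)) ∧
      HasImproperIntegral F s

/-! Discretise. A multiple sequence `S` that vanishes when an index is `0` is realised as the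
integrals over the boxes `∏ [0, k i]` of a smooth function, `smoothDensity S`, so iterated integrals
reduce to iterated limits of `S` (`HasIteratedLimit.hasIteratedImproperIntegral`). An iterated limit
sends the innermost index to infinity first, so it only sees indices in one strict order, a
different one for each `σ`. `sortedSequence` reads off that order and returns `c σ` at the smallest
index, with `c σ k → s σ`. -/

/-! ### Smooth steps -/

/-- A smooth step, equal to `0` for `t ≤ 1 / 3` and to `1` for `2 / 3 ≤ t`. -/
noncomputable def smoothStep (t : ℝ) : ℝ := Real.smoothTransition (3 * t - 1)

theorem smoothStep_contDiff : ContDiff ℝ ∞ smoothStep :=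
  Real.smoothTransition.contDiff.comp ((contDiff_const.mul contDiff_id).sub contDiff_const)

theorem smoothStep_of_le {t : ℝ} (h : t ≤ 1 / 3) : smoothStep t = 0 :=
  Real.smoothTransition.zero_of_nonpos (by linarith)

theorem smoothStep_of_ge {t : ℝ} (h : 2 / 3 ≤ t) : smoothStep t = 1 :=
  Real.smoothTransition.one_of_one_le (by linarith)

theorem deriv_smoothStep_contDiff : ContDiff ℝ ∞ (deriv smoothStep) :=
  (contDiff_infty_iff_deriv.1 smoothStep_contDiff).2

theorem hasDerivAt_smoothStep (t : ℝ) : HasDerivAt smoothStep (deriv smoothStep t) t :=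
  (smoothStep_contDiff.differentiable (by simp) t).hasDerivAt

theorem deriv_smoothStep_of_lt {t : ℝ} (h : t < 1 / 3) : deriv smoothStep t = 0 := by
  have : smoothStep =ᶠ[𝓝 t] fun _ => 0 := by
    filter_upwards [Iio_mem_nhds h] with u hu using smoothStep_of_le (le_of_lt hu)
  rw [this.deriv_eq, deriv_const]

theorem deriv_smoothStep_of_gt {t : ℝ} (h : 2 / 3 < t) : deriv smoothStep t = 0 := by
  have : smoothStep =ᶠ[𝓝 t] fun _ => 1 := by
    filter_upwards [Ioi_mem_nhds h] with u hu using smoothStep_of_ge (le_of_lt hu)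
  rw [this.deriv_eq, deriv_const]

/-- Near a point, the floor is that of the point, or it is one less and both fractional parts lie
where `smoothStep` is locally constant. -/
theorem eventually_natFloor (t₀ : ℝ) : ∀ᶠ t : ℝ in 𝓝 t₀, ⌊t⌋₊ = ⌊t₀⌋₊ ∨
    (⌊t⌋₊ + 1 = ⌊t₀⌋₊ ∧ 2 / 3 < t - (⌊t⌋₊ : ℝ) ∧ t - (⌊t₀⌋₊ : ℝ) < 1 / 3) := by
  rcases lt_or_ge t₀ 0 with h0 | h0
  · filter_upwards [Iio_mem_nhds h0] with t ht
    left
    rw [Nat.floor_of_nonpos (le_of_lt ht), Nat.floor_of_nonpos h0.le]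
  · have h1 := Nat.floor_le h0
    have h2 := Nat.lt_floor_add_one t₀
    generalize ⌊t₀⌋₊ = m at h1 h2 ⊢
    filter_upwards [Ioo_mem_nhds (show (m : ℝ) - 1 / 3 < t₀ by linarith) h2] with t ⟨ht1, ht2⟩
    rcases le_or_gt (m : ℝ) t with h | h
    · left
      exact (Nat.floor_eq_iff ((Nat.cast_nonneg m).trans h)).2 ⟨h, ht2⟩
    · rcases m with _ | m
      · left
        exact Nat.floor_of_nonpos (by simpa using h.le)
      · right
        push_cast at *
        have : ⌊t⌋₊ = m := (Nat.floor_eq_iff (by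
          have : (0 : ℝ) ≤ m := Nat.cast_nonneg m
          linarith)).2 ⟨by linarith, h⟩
        rw [this]
        exact ⟨rfl, by linarith, by linarith⟩

/-! ### The smooth density -/

/-- The bump `deriv smoothStep`, repeated on all intervals `[m, m + 1]`. -/
noncomputable def periodicBump (t : ℝ) : ℝ := deriv smoothStep (t - ⌊t⌋₊)

/-- The smooth function on the quadrant whose integrals over the cubes with integral vertices are
the mixed differences of `S`. -/
noncomputable def smoothDensity {n : ℕ} (S : (Fin n → ℕ) → ℝ) (x : Fin n → ℝ) : ℝ :=
  (∏ i, periodicBump (x i)) *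
    ∑ e : Fin n → Bool, (∏ i, if e i then (1 : ℝ) else -1) * S (fun i => ⌊x i⌋₊ + (e i).toNat)

theorem smoothDensity_contDiff {n : ℕ} (S : (Fin n → ℕ) → ℝ) : ContDiff ℝ ∞ (smoothDensity S) := by
  rw [contDiff_iff_contDiffAt]
  intro x₀
  have key : smoothDensity S =ᶠ[𝓝 x₀] fun x => (∏ i, deriv smoothStep (x i - ⌊x₀ i⌋₊)) *
      ∑ e : Fin n → Bool, (∏ i, if e i then (1 : ℝ) else -1) *
        S (fun i => ⌊x₀ i⌋₊ + (e i).toNat) := by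
    have h : ∀ᶠ x in 𝓝 x₀, ∀ i, ⌊x i⌋₊ = ⌊x₀ i⌋₊ ∨
        (⌊x i⌋₊ + 1 = ⌊x₀ i⌋₊ ∧
          2 / 3 < x i - (⌊x i⌋₊ : ℝ) ∧ x i - (⌊x₀ i⌋₊ : ℝ) < 1 / 3) :=
      eventually_all.2 fun i =>
        (continuous_apply (A := fun _ => ℝ) i).continuousAt.eventually (eventually_natFloor (x₀ i))
    filter_upwards [h] with x hx
    by_cases hall : ∀ i, ⌊x i⌋₊ = ⌊x₀ i⌋₊
    · simp only [smoothDensity, periodicBump, hall]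
    -- If `x` lies just across an integer from `x₀` in some coordinate, that coordinate's bump
    -- vanishes on both sides.
    · push Not at hall
      obtain ⟨i, hi⟩ := hall
      obtain ⟨-, h1, h2⟩ := (hx i).resolve_left hi
      rw [smoothDensity, Finset.prod_eq_zero (Finset.mem_univ i) (deriv_smoothStep_of_gt h1),
        Finset.prod_eq_zero (Finset.mem_univ i) (deriv_smoothStep_of_lt h2), zero_mul, zero_mul]
  refine ContDiffAt.congr_of_eventuallyEq (ContDiff.contDiffAt ?_) key
  refine ContDiff.mul (contDiff_prod fun i _ => ?_) contDiff_const
  exact deriv_smoothStep_contDiff.comp ((contDiff_apply ℝ ℝ i).sub contDiff_const)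

theorem smoothDensity_comp_perm {n : ℕ} (S : (Fin n → ℕ) → ℝ) (σ : Equiv.Perm (Fin n))
    (y : Fin n → ℝ) :
    smoothDensity S (fun i => y (σ i)) = smoothDensity (fun k => S fun i => k (σ i)) y := by
  unfold smoothDensity
  rw [Equiv.prod_comp σ fun i => periodicBump (y i)]
  congr 1
  refine (Fintype.sum_equiv (σ.symm.arrowCongr (Equiv.refl Bool)) _ _ fun e => ?_).symm
  simp only [Equiv.arrowCongr_apply, Equiv.symm_symm, Function.comp_apply, Equiv.refl_apply]
  rw [Equiv.prod_comp σ fun i => if e i then (1 : ℝ) else -1]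

/-- Freezing the last variable yields a density of the same kind, for a combination of two slices of
`S`. This drives the induction on dimension, at non-integral `t` too. -/
theorem smoothDensity_snoc {n : ℕ} (S : (Fin (n + 1) → ℕ) → ℝ) (y : Fin n → ℝ) (t : ℝ) :
    smoothDensity S (Fin.snoc y t) = smoothDensity (fun k =>
      periodicBump t * S (Fin.snoc k (⌊t⌋₊ + 1)) + -periodicBump t * S (Fin.snoc k ⌊t⌋₊)) y := by
  have h : ∀ (e : Fin n → Bool) (b : Bool),
      (fun i => ⌊(Fin.snoc y t : Fin (n + 1) → ℝ) i⌋₊ +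
        ((Fin.snoc e b : Fin (n + 1) → Bool) i).toNat) =
      (Fin.snoc (fun i => ⌊y i⌋₊ + (e i).toNat) (⌊t⌋₊ + b.toNat) : Fin (n + 1) → ℕ) := by
    intro e b
    funext i
    refine Fin.lastCases ?_ (fun i => ?_) i <;> simp
  unfold smoothDensity
  rw [← Equiv.sum_comp (Fin.snocEquiv fun _ => Bool), Fintype.sum_prod_type, Fintype.sum_bool]
  simp only [Fin.snocEquiv, Equiv.coe_fn_mk, Fin.prod_univ_castSucc, Fin.snoc_castSucc,
    Fin.snoc_last, h, Bool.toNat_true, Bool.toNat_false, add_zero]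
  rw [← Finset.sum_add_distrib, Finset.mul_sum, Finset.mul_sum]
  refine Finset.sum_congr rfl fun e _ => ?_
  simp
  ring

/-! ### From iterated limits to iterated integrals -/

/-- Iterated limit of a multiple sequence, the first index tending to infinity first, where the
sequence has to vanish when an index is `0`. -/
def HasIteratedLimit : (n : ℕ) → ((Fin n → ℕ) → ℝ) → EReal → Prop
  | 0, S, s => s = ((S Fin.elim0 : ℝ) : EReal)
  | n + 1, S, s => ∃ L : ℕ → ℝ,
      (∀ k, HasIteratedLimit n (fun y => S (Fin.snoc y k)) ((L k : ℝ) : EReal)) ∧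
      L 0 = 0 ∧ Tendsto (fun k => (L k : EReal)) atTop (𝓝 s)

theorem HasIteratedLimit.linearCombination {n : ℕ} {S T : (Fin n → ℕ) → ℝ} {a b : ℝ}
    (hS : HasIteratedLimit n S a) (hT : HasIteratedLimit n T b) (c d : ℝ) :
    HasIteratedLimit n (fun y => c * S y + d * T y) ((c * a + d * b : ℝ) : EReal) := by
  induction n generalizing a b with
  | zero =>
    simp only [HasIteratedLimit, EReal.coe_eq_coe_iff] at hS hT ⊢
    rw [hS, hT]
  | succ n ih =>
    obtain ⟨L, hL, hL0, hLt⟩ := hS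
    obtain ⟨K, hK, hK0, hKt⟩ := hT
    refine ⟨fun k => c * L k + d * K k, fun k => ih (hL k) (hK k), by simp [hL0, hK0], ?_⟩
    rw [EReal.tendsto_coe] at hLt hKt ⊢
    exact (hLt.const_mul c).add (hKt.const_mul d)

theorem hasRiemannIntegral_of_hasDerivAt {g G : ℝ → ℝ} (hg : Continuous g)
    (hG : ∀ t, HasDerivAt G (g t) t) {a b : ℝ} (h : a < b) :
    HasRiemannIntegral g a b h (G b - G a) := by
  have h1 := MeasureTheory.ContinuousOn.hasBoxIntegral (E := ℝ) (I := intervalBox a b h) MeasureTheory.volume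
    (f := fun y : Fin 1 → ℝ => g (y 0)) (by fun_prop) BoxIntegral.IntegrationParams.Riemann
  have h2 : ∫ y in (intervalBox a b h : Set (Fin 1 → ℝ)), g (y 0) = G b - G a := by
    rw [← intervalIntegral.integral_eq_sub_of_hasDerivAt (fun t _ => hG t)
      (hg.intervalIntegrable a b), intervalIntegral.integral_of_le h.le,
      ← (MeasureTheory.volume_preserving_funUnique (Fin 1) ℝ).setIntegral_preimage_emb
        (MeasurableEquiv.measurableEmbedding _)]
    congr 2
    ext y
    simp [BoxIntegral.Box.mem_def, intervalBox]
  rw [h2] at h1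
  exact h1

theorem hasImproperIntegral_of_tendsto {L : ℕ → ℝ} {s : EReal} (h0 : L 0 = 0)
    (hL : Tendsto (fun k => (L k : EReal)) atTop (𝓝 s)) :
    HasImproperIntegral (fun t => periodicBump t * L (⌊t⌋₊ + 1) + -periodicBump t * L ⌊t⌋₊) s := by
  set g : ℝ → ℝ := fun t => periodicBump t * L (⌊t⌋₊ + 1) + -periodicBump t * L ⌊t⌋₊ with hg
  -- The primitive interpolates `L` monotonically between consecutive integers.
  set G : ℝ → ℝ := fun t => L ⌊t⌋₊ + smoothStep (t - ⌊t⌋₊) * (L (⌊t⌋₊ + 1) - L ⌊t⌋₊) with hGdef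
  have hgc : Continuous g := by
    rw [continuous_iff_continuousAt]
    intro t₀
    have h : g =ᶠ[𝓝 t₀] fun t => deriv smoothStep (t - ⌊t₀⌋₊) * (L (⌊t₀⌋₊ + 1) - L ⌊t₀⌋₊) := by
      filter_upwards [eventually_natFloor t₀] with t ht
      rcases ht with ht | ⟨-, h1, h2⟩
      · simp only [hg, periodicBump, ht]
        ring
      · simp [hg, periodicBump, deriv_smoothStep_of_gt h1, deriv_smoothStep_of_lt h2]
    refine ContinuousAt.congr (Continuous.continuousAt ?_) h.symm
    exact (deriv_smoothStep_contDiff.continuous.comp (continuous_id.sub continuous_const)).mul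
      continuous_const
  have hG : ∀ t, HasDerivAt G (g t) t := by
    intro t₀
    have h : G =ᶠ[𝓝 t₀]
        fun t => L ⌊t₀⌋₊ + smoothStep (t - ⌊t₀⌋₊) * (L (⌊t₀⌋₊ + 1) - L ⌊t₀⌋₊) := by
      filter_upwards [eventually_natFloor t₀] with t ht
      rcases ht with ht | ⟨h0, h1, h2⟩
      · simp only [hGdef, ht]
      · simp [hGdef, smoothStep_of_ge h1.le, smoothStep_of_le h2.le, h0]
    refine HasDerivAt.congr_of_eventuallyEq ?_ h
    have h1 : HasDerivAt (fun t => smoothStep (t - ⌊t₀⌋₊)) (periodicBump t₀) t₀ :=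
      (hasDerivAt_smoothStep (t₀ - ⌊t₀⌋₊)).comp_sub_const t₀ _
    refine ((h1.mul_const (L (⌊t₀⌋₊ + 1) - L ⌊t₀⌋₊)).const_add _).congr_deriv ?_
    simp only [hg]
    ring
  have hG0 : G 0 = 0 := by simp [hGdef, h0, smoothStep_of_le]
  refine ⟨G, fun R hR => by simpa [hG0] using hasRiemannIntegral_of_hasDerivAt hgc hG hR, ?_⟩
  have hfl : Tendsto (fun t : ℝ => ⌊t⌋₊) atTop atTop := tendsto_nat_floor_atTop
  have t1 := hL.comp hfl
  have t2 := ((tendsto_add_atTop_iff_nat 1).2 hL).comp hfl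
  -- Squeezing `G` between the min and max of two consecutive terms also covers infinite `s`.
  have tmin := t1.min t2
  have tmax := t1.max t2
  rw [min_self] at tmin
  rw [max_self] at tmax
  refine tendsto_of_tendsto_of_tendsto_of_le_of_le tmin tmax (fun t => ?_) fun t => ?_
  · have h1 := Real.smoothTransition.nonneg (3 * (t - ⌊t⌋₊) - 1)
    have h2 := Real.smoothTransition.le_one (3 * (t - ⌊t⌋₊) - 1)
    simp only [Function.comp_apply, min_le_iff, EReal.coe_le_coe_iff, hGdef, smoothStep]
    rcases le_total (L ⌊t⌋₊) (L (⌊t⌋₊ + 1)) with h | h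
    · left; nlinarith
    · right; nlinarith
  · have h1 := Real.smoothTransition.nonneg (3 * (t - ⌊t⌋₊) - 1)
    have h2 := Real.smoothTransition.le_one (3 * (t - ⌊t⌋₊) - 1)
    simp only [Function.comp_apply, le_max_iff, EReal.coe_le_coe_iff, hGdef, smoothStep]
    rcases le_total (L ⌊t⌋₊) (L (⌊t⌋₊ + 1)) with h | h
    · right; nlinarith
    · left; nlinarith

theorem HasIteratedLimit.hasIteratedImproperIntegral {n : ℕ} {S : (Fin n → ℕ) → ℝ} {s : EReal}
    (h : HasIteratedLimit n S s) : HasIteratedImproperIntegral n (smoothDensity S) s := by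
  induction n generalizing s with
  | zero =>
    simp only [HasIteratedLimit, HasIteratedImproperIntegral] at h ⊢
    rw [h]
    simp only [smoothDensity, Finset.univ_eq_empty, Finset.prod_empty, one_mul, Fintype.sum_unique]
    congr 2
    exact Subsingleton.elim _ _
  | succ n ih =>
    obtain ⟨L, hL, h0, ht⟩ := h
    refine ⟨_, fun t _ => ?_, hasImproperIntegral_of_tendsto h0 ht⟩
    simp only [smoothDensity_snoc]
    exact ih ((hL _).linearCombination (hL _) _ _)

/-! ### Prescribing the iterated limits -/

/-- A multiple sequence which depends only on the relative position of its indices and finitely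
many constants has an iterated limit. -/
theorem hasIteratedLimit_of_strictMono_invariant {n : ℕ} {S : (Fin n → ℕ) → ℝ} (M : ℕ)
    (hS : ∀ g : ℕ → ℕ, StrictMono g → (∀ m < M, g m = m) → ∀ y, S (g ∘ y) = S y)
    (h0 : ∀ y i, y i = 0 → S y = 0) :
    HasIteratedLimit n S (S fun i => M + (i.rev : ℕ) : ℝ) := by
  induction n generalizing M with
  | zero =>
    simp only [HasIteratedLimit, EReal.coe_eq_coe_iff]
    congr 1
    exact Subsingleton.elim _ _
  | succ n ih =>
    -- Once the last index is frozen at `k`, it counts as a constant, so the bound grows to `max M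
    -- (k + 1)`.
    refine ⟨fun k => S (Fin.snoc (fun i => max M (k + 1) + (i.rev : ℕ)) k), fun k => ?_,
      h0 _ (Fin.last n) (Fin.snoc_last _ _), ?_⟩
    · refine ih (S := fun y => S (Fin.snoc y k)) (max M (k + 1))
        (fun g hg hgm y => ?_) fun y i hi => h0 _ i.castSucc (by simpa using hi)
      have := hS g hg (fun m hm => hgm m (by omega)) (Fin.snoc y k)
      rwa [Fin.comp_snoc, hgm k (by omega)] at this
    · refine tendsto_const_nhds.congr' ?_
      filter_upwards [eventually_ge_atTop M] with k hk
      -- Shifting everything from `M` on by `k - M` matches the two points, so the slice limits are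
      -- constant for `k ≥ M`.
      rw [EReal.coe_eq_coe_iff, ← hS (fun m => if m < M then m else m + (k - M))
        (fun a b hab => by dsimp only; split_ifs <;> omega) (fun m hm => if_pos hm)]
      congr 1
      funext i
      refine Fin.lastCases ?_ (fun i => ?_) i
      · simp; omega
      · have := i.isLt
        simp only [Function.comp_apply, Fin.snoc_castSucc, Fin.val_rev, Fin.val_castSucc]
        split_ifs <;> omega

theorem exists_tendsto_ereal (s : EReal) :
    ∃ c : ℕ → ℝ, c 0 = 0 ∧ Tendsto (fun k => (c k : EReal)) atTop (𝓝 s) := by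
  induction s with
  | bot =>
    refine ⟨fun k => -k, by simp, ?_⟩
    exact EReal.tendsto_coe_nhds_bot_iff.2 (tendsto_neg_atTop_atBot.comp tendsto_natCast_atTop_atTop)
  | top =>
    exact ⟨fun k => k, by simp, EReal.tendsto_coe_nhds_top_iff.2 tendsto_natCast_atTop_atTop⟩
  | coe r =>
    refine ⟨fun k => if k = 0 then 0 else r, by simp, tendsto_const_nhds.congr' ?_⟩
    filter_upwards [eventually_ne_atTop 0] with k hk
    simp [hk]

open Classical in
/-- A multiple sequence which at `y` with pairwise distinct entries is `c τ (min y)`, where `τ`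
sorts `y` in decreasing order. -/
noncomputable def sortedSequence {n : ℕ} (c : Equiv.Perm (Fin (n + 1)) → ℕ → ℝ)
    (y : Fin (n + 1) → ℕ) : ℝ :=
  ∑ τ : Equiv.Perm (Fin (n + 1)),
    if StrictAnti (fun i => y (τ i)) then c τ (y (τ (Fin.last n))) else 0

theorem sortedSequence_eq_zero {n : ℕ} {c : Equiv.Perm (Fin (n + 1)) → ℕ → ℝ}
    (hc : ∀ τ, c τ 0 = 0) {y : Fin (n + 1) → ℕ} {i : Fin (n + 1)} (hi : y i = 0) :
    sortedSequence c y = 0 := by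
  refine Finset.sum_eq_zero fun τ _ => ?_
  split_ifs with h
  · have h1 : y (τ (Fin.last n)) ≤ y (τ (τ.symm i)) := h.antitone (Fin.le_last _)
    rw [τ.apply_symm_apply, hi, Nat.le_zero] at h1
    rw [h1, hc]
  · rfl

/-- The value depends only on the order of the entries and on their minimum, which is at most `y i`
and hence fixed by `g`. -/
theorem sortedSequence_comp_strictMono {n : ℕ} (c : Equiv.Perm (Fin (n + 1)) → ℕ → ℝ)
    {g : ℕ → ℕ} (hg : StrictMono g) {y : Fin (n + 1) → ℕ} (i : Fin (n + 1))
    (hgm : ∀ m ≤ y i, g m = m) : sortedSequence c (fun j => g (y j)) = sortedSequence c y := by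
  refine Finset.sum_congr rfl fun τ _ => ?_
  have h : StrictAnti (fun i => g (y (τ i))) ↔ StrictAnti (fun i => y (τ i)) :=
    ⟨fun h a b hab => hg.lt_iff_lt.1 (h hab), fun h a b hab => hg (h hab)⟩
  simp only [h]
  split_ifs with h'
  · rw [hgm]
    simpa using h'.antitone (Fin.le_last (τ.symm i))
  · rfl

theorem sortedSequence_of_strictAnti {n : ℕ} (c : Equiv.Perm (Fin (n + 1)) → ℕ → ℝ)
    (σ : Equiv.Perm (Fin (n + 1))) {y : Fin (n + 1) → ℕ} (hy : StrictAnti y) :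
    sortedSequence c (fun i => y (σ⁻¹ i)) = c σ (y (Fin.last n)) := by
  rw [sortedSequence, Finset.sum_eq_single σ]
  · simp [hy]
  · intro τ _ hτ
    refine if_neg fun h => hτ ?_
    have h1 : StrictMono (σ⁻¹ * τ) := fun a b hab => hy.lt_iff_gt.1 (h hab)
    -- A finite chain has no order automorphism but the identity.
    have h2 : ⇑(σ⁻¹ * τ) = id := by
      have := Subsingleton.elim (h1.orderIsoOfSurjective _ (σ⁻¹ * τ).surjective)
        (OrderIso.refl (Fin (n + 1)))
      exact congrArg DFunLike.coe this
    exact (inv_mul_eq_one.1 (Equiv.coe_fn_injective h2)).symm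
  · simp

theorem sortedSequence_hasIteratedLimit {n : ℕ} {c : Equiv.Perm (Fin (n + 1)) → ℕ → ℝ}
    (hc : ∀ τ, c τ 0 = 0) (σ : Equiv.Perm (Fin (n + 1))) {s : EReal}
    (hs : Tendsto (fun k => (c σ k : EReal)) atTop (𝓝 s)) :
    HasIteratedLimit (n + 1) (fun y => sortedSequence c fun i => y (σ⁻¹ i)) s := by
  refine ⟨c σ, fun k => ?_, hc σ, hs⟩
  have h := hasIteratedLimit_of_strictMono_invariant
    (S := fun y : Fin n → ℕ => sortedSequence c fun i => (Fin.snoc y k : Fin (n + 1) → ℕ) (σ⁻¹ i))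
    (k + 1) (fun g hg hgm y => ?_)
    (fun y i hi => sortedSequence_eq_zero hc (i := σ i.castSucc) (by simpa using hi))
  · have hy : StrictAnti (Fin.snoc (fun i : Fin n => k + 1 + (i.rev : ℕ)) k : Fin (n + 1) → ℕ) := by
      intro a b hab
      induction b using Fin.lastCases with
      | last =>
        induction a using Fin.lastCases with
        | last => exact absurd hab (lt_irrefl _)
        | cast a => simp only [Fin.snoc_castSucc, Fin.snoc_last]; omega
      | cast b =>
        induction a using Fin.lastCases with
        | last => exact absurd hab (Fin.le_last _).not_gt
        | cast a =>
          have : (a : ℕ) < b := by simpa using hab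
          simp only [Fin.snoc_castSucc, Fin.val_rev]
          omega
    rwa [sortedSequence_of_strictAnti c σ hy, Fin.snoc_last] at h
  · have h1 := sortedSequence_comp_strictMono c hg
      -- Coordinate `σ (Fin.last n)` carries the frozen index `k`.
      (y := fun i => (Fin.snoc y k : Fin (n + 1) → ℕ) (σ⁻¹ i)) (σ (Fin.last n))
      (fun m hm => hgm m (by simp at hm; omega))
    rw [← h1]
    have h2 := Fin.comp_snoc g y k
    rw [hgm k (by omega)] at h2
    rw [← h2]
    rfl

/-- In the integral for `σ`, the `k`-th variable of integration (counted from the inside) is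
`y k = x (σ k)`, so that the point `x` has the coordinates `x i = y (σ⁻¹ i)`. -/
theorem corollary3 (n : ℕ) (hn : 2 ≤ n) (s : Equiv.Perm (Fin n) → EReal) :
    ∃ f : (Fin n → ℝ) → ℝ,
      ContDiffOn ℝ ∞ f {x : Fin n → ℝ | ∀ i, 0 ≤ x i} ∧
      ∀ σ : Equiv.Perm (Fin n),
        HasIteratedImproperIntegral n (fun y => f (fun i => y (σ⁻¹ i))) (s σ) := by
  obtain ⟨n, rfl⟩ : ∃ m, n = m + 1 := ⟨n - 1, by omega⟩
  choose c hc0 hc using fun σ => exists_tendsto_ereal (s σ)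
  refine ⟨smoothDensity (sortedSequence c), (smoothDensity_contDiff _).contDiffOn, fun σ => ?_⟩
  simp only [smoothDensity_comp_perm]
  exact (sortedSequence_hasIteratedLimit hc0 σ (hc σ)).hasIteratedImproperIntegral
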